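/- All posets are finite. Let $P=(X,\prec)$ be a poset; write $x\parallel y$ if $x,y$ are distinct and incomparable. Two distinct points $x,y$ are *twins* if for every $z\in X$ we have $z\prec x\iff z\prec y$ and $x\prec z\iff y\prec z$; $P$ is *twin-free* if it contains no twins. $P$ is an *interval order* if each $x\in X$ can be assigned a nonempty bounded real interval $I_x$ so that $x\prec y$ if and only if every point of $I_x$ is less than every point of $I_y$. $P$ is a *unit OC interval order* if this is possible with all intervals of the same positive length, each $I_x$ being either an open interval $(L(x),R(x))$ or a closed interval $[L(x),R(x)]$. $P$ is an *$AB$-order* if there are intervals $I_x$, $x\in X$, all of the same positive length, with left endpoint $L(x)$, right endpoint $R(x)$ and center $c(x)$, each of type $A$ (both endpoints and the center labelled closed) or of type $B$ (both endpoints and the center labelled open), such that $x\prec y$ if and only if (i) $R(x)<c(y)$, or (ii) $R(x)=c(y)$, at least one of $R(x),c(y)$ is open, and at least one of $L(y),c(x)$ is open. Consider the following posets, in which only the relations implied by the listed ones hold: * $\mathbf{4}+\mathbf{1}$: a chain of four elements and one element incomparable to all of them; * $\mathbf{3}+\mathbf{1}+\mathbf{1}$: a chain of three elements and two further elements, each incomparable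 to every other element; * $Z$ on $\{x,y,z,w,u,v\}$: $x\prec y\prec z\prec w$, $u\prec w$, $x\prec v$; * $D$ on $\{x,y,w,z,v\}$: $x\prec y\prec z$, $x\prec w\prec z$, with $y\parallel w$ and $v$ incomparable to every other element; * $Y$ on $\{x,y,z,w,v\}$: $x\prec y\prec z$, $y\prec w$, with $z\parallel w$ and $v$ incomparable to every other element. **Theorem.** The following are equivalent for a finite twin-free poset $P$. 1. $P$ is a unit OC interval order. 2. $P$ is an $AB$-order. 3. $P$ is an interval order that contains none of $\mathbf{4}+\mathbf{1}$, $\mathbf{3}+\mathbf{1}+\mathbf{1}$, $Z$, $D$, $Y$ and the dual of $Y$ as an induced poset. -/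

import Mathlib

/-- All points of `I` are less than all points of `J`. -/
def SetPrecedes (I J : Set ℝ) : Prop := ∀ a ∈ I, ∀ b ∈ J, a < b

/-- Interval order: each `x` gets a (nonempty, bounded) real interval `I x`, open, closed or
half-open, such that `x < y` iff all points of `I x` are less than all points of `I y`. -/
def IsIntervalOrder (X : Type*) [PartialOrder X] : Prop :=
  ∃ I : X → Set ℝ,
    (∀ x, (I x).Nonempty ∧ (I x).OrdConnected ∧ BddBelow (I x) ∧ BddAbove (I x)) ∧
    ∀ x y, x < y ↔ SetPrecedes (I x) (I y)

/-- Unit OC interval order: as for interval orders, where all intervals have the same positive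
length and each of them is either a closed or an open interval. -/
def IsUnitOCIntervalOrder (X : Type*) [PartialOrder X] : Prop :=
  ∃ len : ℝ, 0 < len ∧ ∃ I : X → Set ℝ,
    (∀ x, ∃ l : ℝ, I x = Set.Icc l (l + len) ∨ I x = Set.Ioo l (l + len)) ∧
    ∀ x y, x < y ↔ SetPrecedes (I x) (I y)

/-- The four types of intervals with a labelled center. -/
inductive IntervalType
  | A
  | B
  | C
  | D

/-- Both endpoints are open (types `B` and `D`); otherwise both are closed. -/
def IntervalType.EndpointsOpen : IntervalType → Prop
  | .A => False
  | .B => True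
  | .C => False
  | .D => True

/-- The center is labelled open (types `B` and `C`); otherwise it is labelled closed. -/
def IntervalType.CenterOpen : IntervalType → Prop
  | .A => False
  | .B => True
  | .C => True
  | .D => False

/-- An `S`-representation of a poset by intervals of a common positive length `len`. -/
structure SRepresentation (S : Set IntervalType) (X : Type*) [PartialOrder X] where
  /-- the common length -/
  len : ℝ
  len_pos : 0 < len
  /-- the left endpoint -/
  L : X → ℝ
  /-- the right endpoint -/
  R : X → ℝ
  /-- the center -/
  c : X → ℝ
  R_eq : ∀ x, R x = L x + len
  c_eq : ∀ x, c x = (L x + R x) / 2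
  /-- the type of the interval -/
  type : X → IntervalType
  type_mem : ∀ x, type x ∈ S
  lt_iff : ∀ x y, x < y ↔
    (R x < c y ∨
      (R x = c y ∧
        ((type x).EndpointsOpen ∨ (type y).CenterOpen) ∧
        ((type y).EndpointsOpen ∨ (type x).CenterOpen)))

/-- An `S`-order is a poset with an `S`-representation. -/
def IsSOrder (S : Set IntervalType) (X : Type*) [PartialOrder X] : Prop :=
  Nonempty (SRepresentation S X)

/-- Two distinct points are twins if they have the same comparabilities. -/
def AreTwins {X : Type*} [PartialOrder X] (x y : X) : Prop :=
  x ≠ y ∧ ∀ z, (z < x ↔ z < y) ∧ (x < z ↔ y < z)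

/-- A poset without twins. -/
def IsTwinFree (X : Type*) [PartialOrder X] : Prop :=
  ∀ x y : X, ¬ AreTwins x y

/-- `Q` is isomorphic to an induced subposet of `X`. -/
def ContainsInduced (Q X : Type*) [PartialOrder Q] [PartialOrder X] : Prop :=
  Nonempty (Q ↪o X)

/-- The poset `4 + 1`: a chain of four elements and one element incomparable to it. -/
abbrev FourPlusOne : Type := Fin 4 ⊕ Fin 1

/-- The poset `3 + 1 + 1`: a chain of three elements and two further elements, each incomparable
to every other element. -/
abbrev ThreePlusOnePlusOne : Type := Fin 3 ⊕ (Fin 1 ⊕ Fin 1)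

/-- The ground set of the poset `Z`. -/
inductive PosetZ
  | x
  | y
  | z
  | w
  | u
  | v

/-- The strict order of `Z`: the chain `x < y < z < w`, with `u < w` and `x < v`. -/
def PosetZ.Below : PosetZ → PosetZ → Prop
  | .x, .y => True
  | .x, .z => True
  | .x, .w => True
  | .y, .z => True
  | .y, .w => True
  | .z, .w => True
  | .u, .w => True
  | .x, .v => True
  | _, _ => False

instance : PartialOrder PosetZ where
  le a b := a = b ∨ PosetZ.Below a b
  le_refl a := Or.inl rfl
  le_trans a b c := by
    cases a <;> cases b <;> cases c <;> simp [PosetZ.Below]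
  le_antisymm a b := by
    cases a <;> cases b <;> simp [PosetZ.Below]

/-- The ground set of the poset `D`. -/
inductive PosetD
  | x
  | y
  | w
  | z
  | v

/-- The strict order of `D`: the diamond `x < y < z`, `x < w < z` with `y`, `w` incomparable,
and `v` incomparable to every other element. -/
def PosetD.Below : PosetD → PosetD → Prop
  | .x, .y => True
  | .x, .w => True
  | .x, .z => True
  | .y, .z => True
  | .w, .z => True
  | _, _ => False

instance : PartialOrder PosetD where
  le a b := a = b ∨ PosetD.Below a b
  le_refl a := Or.inl rfl
  le_trans a b c := by
    cases a <;> cases b <;> cases c <;> simp [PosetD.Below]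
  le_antisymm a b := by
    cases a <;> cases b <;> simp [PosetD.Below]

/-- The ground set of the poset `Y`. -/
inductive PosetY
  | x
  | y
  | z
  | w
  | v

/-- The strict order of `Y`: `x < y < z` and `y < w` with `z`, `w` incomparable, and `v`
incomparable to every other element. -/
def PosetY.Below : PosetY → PosetY → Prop
  | .x, .y => True
  | .x, .z => True
  | .x, .w => True
  | .y, .z => True
  | .y, .w => True
  | _, _ => False

instance : PartialOrder PosetY where
  le a b := a = b ∨ PosetY.Below a b
  le_refl a := Or.inl rfl
  le_trans a b c := by
    cases a <;> cases b <;> cases c <;> simp [PosetY.Below]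
  le_antisymm a b := by
    cases a <;> cases b <;> simp [PosetY.Below]

/-! ### Unit interval models and their common normal form -/

section IntervalRepresentations

/-! Both interval models reduce to `IsUnitRep`: a real position and a set of open points, where
equality at unit distance counts as precedence exactly when one of the two points is open. There an
induced 3+1, with chain a ≺ b ≺ c and side point d, is rigid (`IsUnitRep.rigid`): b and d share a
position, a and c lie one unit to either side, b is open and the other three are closed.
Twin-freeness makes position and label determine a point, so a forbidden poset forces two points to
coincide, contradictory labels, or too long a chain.

Conversely, the exclusions make the 3+1s nearly unique (`Admissible`), and their bottoms, tops and
sides are never middles of others. The non-middle points form a semiorder, linearly ordered by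
traces in the whole poset. A greedy placement (`exists_tight_unit_rep`) represents it by closed
intervals, with every side exactly one unit from its bottom and top. Each middle then returns as an
open interval at the position of its side: the two compare alike with everything except that bottom
and top (`Admissible.exists_isUnitRep`). -/

lemma setPrecedes_mono {I I' J J' : Set ℝ} (hI : I' ⊆ I) (hJ : J' ⊆ J)
    (h : SetPrecedes I J) : SetPrecedes I' J' :=
  fun a ha b hb => h a (hI ha) b (hJ hb)

lemma le_of_setPrecedes_Ioo {l m w : ℝ} (hw : 0 < w)
    (h : SetPrecedes (Set.Ioo l (l + w)) (Set.Ioo m (m + w))) : l + w ≤ m := by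
  by_contra! hlt
  -- Moving in from both ends by half the overlap, capped by the length, gives two points inside the
  -- intervals in the wrong order.
  have he : 0 < min w (l + w - m) := lt_min hw (by linarith)
  have h1 := min_le_left w (l + w - m)
  have h2 := min_le_right w (l + w - m)
  have := h (l + w - min w (l + w - m) / 2) ⟨by linarith, by linarith⟩
    (m + min w (l + w - m) / 2) ⟨by linarith, by linarith⟩
  linarith

lemma setPrecedes_Icc_Icc {l m w : ℝ} (hw : 0 < w) :
    SetPrecedes (Set.Icc l (l + w)) (Set.Icc m (m + w)) ↔ l + w < m :=
  ⟨fun h => h _ ⟨by linarith, le_rfl⟩ _ ⟨le_rfl, by linarith⟩,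
    fun h _ ha _ hb => by linarith [ha.2, hb.1]⟩

lemma setPrecedes_Icc_Ioo {l m w : ℝ} (hw : 0 < w) :
    SetPrecedes (Set.Icc l (l + w)) (Set.Ioo m (m + w)) ↔ l + w ≤ m :=
  ⟨fun h => le_of_setPrecedes_Ioo hw (setPrecedes_mono Set.Ioo_subset_Icc_self subset_rfl h),
    fun h _ ha _ hb => by linarith [ha.2, hb.1]⟩

lemma setPrecedes_Ioo_Icc {l m w : ℝ} (hw : 0 < w) :
    SetPrecedes (Set.Ioo l (l + w)) (Set.Icc m (m + w)) ↔ l + w ≤ m :=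
  ⟨fun h => le_of_setPrecedes_Ioo hw (setPrecedes_mono subset_rfl Set.Ioo_subset_Icc_self h),
    fun h _ ha _ hb => by linarith [ha.2, hb.1]⟩

lemma setPrecedes_Ioo_Ioo {l m w : ℝ} (hw : 0 < w) :
    SetPrecedes (Set.Ioo l (l + w)) (Set.Ioo m (m + w)) ↔ l + w ≤ m :=
  ⟨le_of_setPrecedes_Ioo hw, fun h _ ha _ hb => by linarith [ha.2, hb.1]⟩

/-- A representation by a real position `g` and a set `o` of open points, at scale `w`. -/
def IsUnitRep {X : Type*} [PartialOrder X] (w : ℝ) (g : X → ℝ) (o : X → Prop) : Prop :=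
  ∀ x y, x < y ↔ (g x + w < g y ∨ (g x + w = g y ∧ (o x ∨ o y)))

variable {X : Type*} [PartialOrder X]

lemma IsUnitRep.rescale {w w' : ℝ} {g : X → ℝ} {o : X → Prop} (hw : 0 < w) (hw' : 0 < w')
    (h : IsUnitRep w g o) : IsUnitRep w' (fun x => w' / w * g x) o := by
  intro x y
  have hr : 0 < w' / w := div_pos hw' hw
  have e : w' / w * g x + w' = w' / w * (g x + w) := by field_simp
  rw [h x y, e, mul_lt_mul_iff_right₀ hr, mul_right_inj' hr.ne']

open Classical in
/-- The interval of length `w` starting at `l`, open or closed. -/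
def ocInterval (w l : ℝ) (p : Prop) : Set ℝ :=
  if p then Set.Ioo l (l + w) else Set.Icc l (l + w)

lemma setPrecedes_ocInterval {w l m : ℝ} (hw : 0 < w) (p q : Prop) :
    SetPrecedes (ocInterval w l p) (ocInterval w m q) ↔
      (l + w < m ∨ (l + w = m ∧ (p ∨ q))) := by
  by_cases hp : p <;> by_cases hq : q <;>
    simp [ocInterval, hp, hq, setPrecedes_Icc_Icc hw, setPrecedes_Icc_Ioo hw,
      setPrecedes_Ioo_Icc hw, setPrecedes_Ioo_Ioo hw, le_iff_lt_or_eq]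

lemma isUnitOCIntervalOrder_iff :
    IsUnitOCIntervalOrder X ↔ ∃ (g : X → ℝ) (o : X → Prop), IsUnitRep 1 g o := by
  constructor
  · rintro ⟨w, hw, I, hI, hlt⟩
    choose l hl using hI
    refine ⟨_, fun x => I x = Set.Ioo (l x) (l x + w), IsUnitRep.rescale (g := l) hw one_pos ?_⟩
    have e : ∀ x, I x = ocInterval w (l x) (I x = Set.Ioo (l x) (l x + w)) := by
      intro x
      unfold ocInterval
      split_ifs with h
      · exact h
      · exact (hl x).resolve_right h
    intro x y
    rw [hlt, ← setPrecedes_ocInterval hw, ← e, ← e]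
  · rintro ⟨g, o, h⟩
    refine ⟨1, one_pos, fun x => ocInterval 1 (g x) (o x), fun x => ⟨g x, ?_⟩, fun x y => ?_⟩
    · by_cases ho : o x <;> simp [ocInterval, ho]
    · rw [h x y, setPrecedes_ocInterval one_pos]

/-- For types `A` and `B` the endpoint and center labels agree, so both openness conditions say that
one of the two points is open. Centers are the positions, and half the length is the unit. -/
lemma isSOrder_AB_iff :
    IsSOrder {IntervalType.A, IntervalType.B} X ↔
      ∃ (g : X → ℝ) (o : X → Prop), IsUnitRep 1 g o := by
  classical
  constructor
  · rintro ⟨S⟩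
    refine ⟨_, fun x => S.type x = .B,
      IsUnitRep.rescale (g := S.c) (half_pos S.len_pos) one_pos fun x y => ?_⟩
    have e : S.c x + S.len / 2 = S.R x := by
      rw [S.c_eq, S.R_eq]; ring
    rw [S.lt_iff, e]
    have hx := S.type_mem x
    have hy := S.type_mem y
    simp only [Set.mem_insert_iff, Set.mem_singleton_iff] at hx hy
    rcases hx with hx | hx <;> rcases hy with hy | hy <;>
      simp [hx, hy, IntervalType.EndpointsOpen, IntervalType.CenterOpen]
  · rintro ⟨g, o, h⟩
    refine ⟨⟨2, two_pos, fun x => g x - 1, fun x => g x + 1, g, fun x => by ring,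
      fun x => by ring, fun x => if o x then .B else .A, fun x => ?_, fun x y => ?_⟩⟩
    · split_ifs <;> simp
    · rw [h x y]
      by_cases hx : o x <;> by_cases hy : o y <;>
        simp [hx, hy, IntervalType.EndpointsOpen, IntervalType.CenterOpen]

lemma IsUnitOCIntervalOrder.isIntervalOrder (h : IsUnitOCIntervalOrder X) :
    IsIntervalOrder X := by
  obtain ⟨w, hw, I, hI, hlt⟩ := h
  refine ⟨I, fun x => ?_, hlt⟩
  obtain ⟨l, hl | hl⟩ := hI x <;> rw [hl]
  · exact ⟨Set.nonempty_Icc.2 (by linarith), Set.ordConnected_Icc, bddBelow_Icc, bddAbove_Icc⟩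
  · exact ⟨Set.nonempty_Ioo.2 (by linarith), Set.ordConnected_Ioo, bddBelow_Ioo, bddAbove_Ioo⟩

end IntervalRepresentations

/-! ### Forbidden posets in a unit representation -/

section Necessity

variable {X : Type*} [PartialOrder X] {g : X → ℝ} {o : X → Prop}

lemma IsUnitRep.add_le (h : IsUnitRep 1 g o) {x y : X} (hxy : x < y) : g x + 1 ≤ g y := by
  rcases (h x y).1 hxy with h | h
  · exact h.le
  · exact h.1.le

lemma IsUnitRep.le_add (h : IsUnitRep 1 g o) {x y : X} (hxy : ¬ x < y) : g y ≤ g x + 1 := by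
  by_contra! hlt
  exact hxy ((h x y).2 (Or.inl hlt))

lemma IsUnitRep.not_open_of_eq (h : IsUnitRep 1 g o) {x y : X} (hxy : ¬ x < y)
    (e : g x + 1 = g y) : ¬ o x ∧ ¬ o y := by
  rw [← not_or]
  exact fun ho => hxy ((h x y).2 (Or.inr ⟨e, ho⟩))

lemma IsUnitRep.open_of_eq (h : IsUnitRep 1 g o) {x y : X} (hxy : x < y)
    (e : g x + 1 = g y) : o x ∨ o y := by
  rcases (h x y).1 hxy with h | h
  · exact absurd e h.ne
  · exact h.2

lemma IsUnitRep.eq_of_same (h : IsUnitRep 1 g o) (hX : IsTwinFree X) {x y : X}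
    (e : g x = g y) (ho : o x ↔ o y) : x = y := by
  by_contra hne
  exact hX x y ⟨hne, fun z => ⟨by rw [h, h, e, ho], by rw [h, h, e, ho]⟩⟩

/-- The rigidity of an induced `3 + 1` in a unit representation. -/
lemma IsUnitRep.rigid (h : IsUnitRep 1 g o) {a b c d : X} (hab : a < b) (hbc : b < c)
    (had : ¬ a < d) (hdc : ¬ d < c) :
    g b = g d ∧ g a + 1 = g d ∧ g d + 1 = g c ∧ ¬ o a ∧ o b ∧ ¬ o c ∧ ¬ o d := by
  have h1 := h.add_le hab
  have h2 := h.add_le hbc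
  have h3 := h.le_add had
  have h4 := h.le_add hdc
  -- The chain gives `g a + 2 ≤ g c` and the side point gives the reverse, so every inequality is an
  -- equality.
  have e1 : g a + 1 = g d := by linarith
  have e2 : g d + 1 = g c := by linarith
  have o1 := h.not_open_of_eq had e1
  have o2 := h.not_open_of_eq hdc e2
  exact ⟨by linarith, e1, e2, o1.1,
    (h.open_of_eq hab (by linarith)).resolve_left o1.1, o2.2, o1.2⟩

lemma IsUnitRep.not_fourPlusOne (h : IsUnitRep 1 g o) : ¬ ContainsInduced FourPlusOne X := by
  rintro ⟨f⟩
  have lt (p q : FourPlusOne) (hpq : p < q) : f p < f q := f.lt_iff_lt.2 hpq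
  have nlt (p q : FourPlusOne) (hpq : ¬ p < q) : ¬ f p < f q := fun h => hpq (f.lt_iff_lt.1 h)
  have h1 := h.add_le (lt (.inl 0) (.inl 1) (by simp))
  have h2 := h.add_le (lt (.inl 1) (.inl 2) (by simp))
  have h3 := h.add_le (lt (.inl 2) (.inl 3) (by simp))
  have h4 := h.le_add (nlt (.inl 0) (.inr 0) (by simp))
  have h5 := h.le_add (nlt (.inr 0) (.inl 3) (by simp))
  linarith

lemma IsUnitRep.not_threePlusOnePlusOne (h : IsUnitRep 1 g o) (hX : IsTwinFree X) :
    ¬ ContainsInduced ThreePlusOnePlusOne X := by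
  rintro ⟨f⟩
  have lt (p q : ThreePlusOnePlusOne) (hpq : p < q) : f p < f q := f.lt_iff_lt.2 hpq
  have nlt (p q : ThreePlusOnePlusOne) (hpq : ¬ p < q) : ¬ f p < f q :=
    fun h => hpq (f.lt_iff_lt.1 h)
  have h1 := h.rigid (lt (.inl 0) (.inl 1) (by simp)) (lt (.inl 1) (.inl 2) (by simp))
    (nlt (.inl 0) (.inr (.inl 0)) (by simp)) (nlt (.inr (.inl 0)) (.inl 2) (by simp))
  have h2 := h.rigid (lt (.inl 0) (.inl 1) (by simp)) (lt (.inl 1) (.inl 2) (by simp))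
    (nlt (.inl 0) (.inr (.inr 0)) (by simp)) (nlt (.inr (.inr 0)) (.inl 2) (by simp))
  have e := h.eq_of_same hX (x := f (.inr (.inl 0))) (y := f (.inr (.inr 0)))
    (by linarith) (by tauto)
  simpa using f.injective e

lemma posetZ_lt_iff {p q : PosetZ} : p < q ↔ PosetZ.Below p q := by
  rw [lt_iff_le_not_ge]
  change (p = q ∨ _) ∧ ¬ (q = p ∨ _) ↔ _
  cases p <;> cases q <;> simp [PosetZ.Below]

lemma posetD_lt_iff {p q : PosetD} : p < q ↔ PosetD.Below p q := by
  rw [lt_iff_le_not_ge]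
  change (p = q ∨ _) ∧ ¬ (q = p ∨ _) ↔ _
  cases p <;> cases q <;> simp [PosetD.Below]

lemma posetY_lt_iff {p q : PosetY} : p < q ↔ PosetY.Below p q := by
  rw [lt_iff_le_not_ge]
  change (p = q ∨ _) ∧ ¬ (q = p ∨ _) ↔ _
  cases p <;> cases q <;> simp [PosetY.Below]

/-- As the middle of x, y, z the point y is open; as the bottom of y, z, w it is closed. -/
lemma IsUnitRep.not_posetZ (h : IsUnitRep 1 g o) : ¬ ContainsInduced PosetZ X := by
  rintro ⟨f⟩
  have lt (p q : PosetZ) : f p < f q ↔ PosetZ.Below p q := f.lt_iff_lt.trans posetZ_lt_iff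
  have h1 := h.rigid (a := f .x) (b := f .y) (c := f .z) (d := f .u)
    (by simp [lt, PosetZ.Below]) (by simp [lt, PosetZ.Below])
    (by simp [lt, PosetZ.Below]) (by simp [lt, PosetZ.Below])
  have h2 := h.rigid (a := f .y) (b := f .z) (c := f .w) (d := f .v)
    (by simp [lt, PosetZ.Below]) (by simp [lt, PosetZ.Below])
    (by simp [lt, PosetZ.Below]) (by simp [lt, PosetZ.Below])
  tauto

lemma IsUnitRep.not_posetD (h : IsUnitRep 1 g o) (hX : IsTwinFree X) :
    ¬ ContainsInduced PosetD X := by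
  rintro ⟨f⟩
  have lt (p q : PosetD) : f p < f q ↔ PosetD.Below p q := f.lt_iff_lt.trans posetD_lt_iff
  have h1 := h.rigid (a := f .x) (b := f .y) (c := f .z) (d := f .v)
    (by simp [lt, PosetD.Below]) (by simp [lt, PosetD.Below])
    (by simp [lt, PosetD.Below]) (by simp [lt, PosetD.Below])
  have h2 := h.rigid (a := f .x) (b := f .w) (c := f .z) (d := f .v)
    (by simp [lt, PosetD.Below]) (by simp [lt, PosetD.Below])
    (by simp [lt, PosetD.Below]) (by simp [lt, PosetD.Below])
  have e := h.eq_of_same hX (x := f .y) (y := f .w) (by linarith) (by tauto)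
  simpa using f.injective e

lemma IsUnitRep.not_posetY (h : IsUnitRep 1 g o) (hX : IsTwinFree X) :
    ¬ ContainsInduced PosetY X := by
  rintro ⟨f⟩
  have lt (p q : PosetY) : f p < f q ↔ PosetY.Below p q := f.lt_iff_lt.trans posetY_lt_iff
  have h1 := h.rigid (a := f .x) (b := f .y) (c := f .z) (d := f .v)
    (by simp [lt, PosetY.Below]) (by simp [lt, PosetY.Below])
    (by simp [lt, PosetY.Below]) (by simp [lt, PosetY.Below])
  have h2 := h.rigid (a := f .x) (b := f .y) (c := f .w) (d := f .v)
    (by simp [lt, PosetY.Below]) (by simp [lt, PosetY.Below])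
    (by simp [lt, PosetY.Below]) (by simp [lt, PosetY.Below])
  have e := h.eq_of_same hX (x := f .z) (y := f .w) (by linarith) (by tauto)
  simpa using f.injective e

lemma IsUnitRep.dual (h : IsUnitRep 1 g o) :
    IsUnitRep (X := Xᵒᵈ) 1 (fun x => -g (OrderDual.ofDual x))
      (fun x => o (OrderDual.ofDual x)) := by
  intro x y
  rw [← OrderDual.ofDual_lt_ofDual, h, or_comm (a := o (OrderDual.ofDual x))]
  refine or_congr ⟨fun _ => by linarith, fun _ => by linarith⟩ (and_congr_left fun _ => ?_)
  exact ⟨fun _ => by linarith, fun _ => by linarith⟩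

lemma IsTwinFree.dual (hX : IsTwinFree X) : IsTwinFree Xᵒᵈ :=
  fun x y h => hX (OrderDual.ofDual x) (OrderDual.ofDual y)
    ⟨h.1, fun z => ⟨(h.2 (OrderDual.toDual z)).2, (h.2 (OrderDual.toDual z)).1⟩⟩

lemma containsInduced_dual_iff {Q : Type*} [PartialOrder Q] :
    ContainsInduced Qᵒᵈ X ↔ ContainsInduced Q Xᵒᵈ :=
  ⟨fun ⟨f⟩ => ⟨f.dual⟩, fun ⟨f⟩ => ⟨f.dual⟩⟩

end Necessity

/-! ### Greedy placement of a semiorder with tight pairs -/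

section Greedy

lemma exists_lt_forall_lt_of_finite {S : Set ℝ} (hS : S.Finite) {u : ℝ} (h : ∀ s ∈ S, s < u) :
    ∃ v < u, ∀ s ∈ S, s < v := by
  induction S, hS using Set.Finite.induction_on with
  | empty => exact ⟨u - 1, by linarith, by simp⟩
  | @insert a S _ _ ih =>
    obtain ⟨v, hv, hSv⟩ := ih fun s hs => h s (Or.inr hs)
    obtain ⟨w, hw, hwu⟩ := exists_between (max_lt hv (h a (Or.inl rfl)))
    refine ⟨w, hwu, ?_⟩
    rintro s (rfl | hs)
    · exact (le_max_right _ _).trans_lt hw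
    · exact ((hSv s hs).trans_le (le_max_left _ _)).trans hw

/-- A semiorder `r` on a finite linear order, whose thresholds are compatible with the linear
order, has a closed unit representation in which prescribed extremal pairs `T` are exactly at
unit distance. -/
lemma exists_tight_unit_rep {α : Type*} [LinearOrder α] [Finite α] (r T : α → α → Prop)
    (hr : ∀ x y, r x y → x < y) (hr_right : ∀ x y z, r x y → y ≤ z → r x z)
    (hr_left : ∀ x y z, x ≤ y → r y z → r x z)
    (hT : ∀ x y, T x y → x < y ∧ ¬ r x y ∧ (∀ z, y < z → r x z) ∧ ∀ z, z < x → r z y) :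
    ∃ f : α → ℝ, StrictMono f ∧ (∀ x y, r x y ↔ f x + 1 < f y) ∧
      ∀ x y, T x y → f x + 1 = f y := by
  classical
  have := Fintype.ofFinite α
  -- The induction needs an equivalence for `T`: no other pair may be at exactly unit distance.
  suffices H : ∀ s : Finset α, ∃ f : α → ℝ, (∀ x ∈ s, ∀ y ∈ s, x < y → f x < f y) ∧
      (∀ x ∈ s, ∀ y ∈ s, (r x y ↔ f x + 1 < f y)) ∧
      ∀ x ∈ s, ∀ y ∈ s, (T x y ↔ f x + 1 = f y) by
    obtain ⟨f, h1, h2, h3⟩ := H Finset.univ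
    exact ⟨f, fun x y => h1 x (by simp) y (by simp), fun x y => h2 x (by simp) y (by simp),
      fun x y => (h3 x (by simp) y (by simp)).1⟩
  intro s
  induction s using Finset.induction_on_max with
  | empty => exact ⟨fun _ => 0, by simp, by simp, by simp⟩
  | insert a s has ih =>
    obtain ⟨f, hmono, hrf, hTf⟩ := ih
    suffices H : ∃ v, (∀ x ∈ s, f x < v) ∧ (∀ x ∈ s, (r x a ↔ f x + 1 < v)) ∧
        ∀ x ∈ s, (T x a ↔ f x + 1 = v) by
      obtain ⟨v, h1, h2, h3⟩ := H
      have hne : ∀ x ∈ s, x ≠ a := fun x hx => (has x hx).ne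
      have nr : ∀ x y, x ≤ y → ¬ r y x := fun x y hxy h => (hr _ _ h).not_ge hxy
      have nT : ∀ x y, x ≤ y → ¬ T y x := fun x y hxy h => (hT _ _ h).1.not_ge hxy
      have hva : ∀ x ∈ s, ¬ v + 1 < f x ∧ ¬ v + 1 = f x := fun x hx =>
        ⟨by linarith [h1 x hx], fun h => by linarith [h1 x hx]⟩
      simp only [← Finset.mem_coe, Finset.coe_insert]
      refine ⟨Function.update f a v, ?_, ?_, ?_⟩ <;> rintro x (rfl | hx) y (hy | hy) <;>
        try subst hy
      · simp
      · exact fun h => absurd h (has y hy).not_gt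
      · simpa [hne x hx] using fun _ => h1 x hx
      · simpa [hne x hx, hne y hy] using hmono x hx y hy
      · simp [nr y y le_rfl]
      · simpa [hne y hy, nr y x (has y hy).le] using not_lt.1 (hva y hy).1
      · simpa [hne x hx] using h2 x hx
      · simpa [hne x hx, hne y hy] using hrf x hx y hy
      · simp [nT y y le_rfl]
      · simpa [hne y hy, nT y x (has y hy).le] using (hva y hy).2
      · simpa [hne x hx] using h3 x hx
      · simpa [hne x hx, hne y hy] using hTf x hx y hy
    by_cases hall : ∀ x ∈ s, r x a
    · obtain ⟨v, hv⟩ := (s.image f).exists_le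
      have hv' : ∀ x ∈ s, f x ≤ v := fun x hx => hv _ (Finset.mem_image_of_mem f hx)
      refine ⟨v + 2, fun x hx => by linarith [hv' x hx],
        fun x hx => ⟨fun _ => by linarith [hv' x hx], fun _ => hall x hx⟩,
        fun x hx => ⟨fun h => absurd (hall x hx) (hT _ _ h).2.1, fun h => ?_⟩⟩
      linarith [hv' x hx]
    · have hne : (s.filter fun x => ¬ r x a).Nonempty := by
        push Not at hall
        obtain ⟨x, hx⟩ := hall
        exact ⟨x, by simpa using hx⟩
      -- The new value must exceed `f x + 1` exactly for `x < m`, so only `m` can be at unit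
      -- distance from `a`.
      obtain ⟨m, hm, hmin⟩ := Finset.exists_min_image _ id hne
      simp only [Finset.mem_filter, id] at hm hmin
      obtain ⟨hms, hma⟩ := hm
      have hlt : ∀ x ∈ s, x < m → r x a := fun x hx hxm => by
        by_contra h
        exact (hmin x ⟨hx, h⟩).not_gt hxm
      have hge : ∀ x ∈ s, m ≤ x → ¬ r x a := fun x _ hmx h => hma (hr_left _ _ _ hmx h)
      have hmono' : ∀ x ∈ s, m ≤ x → f m ≤ f x := fun x hx hmx => by
        rcases hmx.eq_or_lt with rfl | h
        · exact le_rfl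
        · exact (hmono m hms x hx h).le
      -- An earlier point at or beyond `f m + 1` would be related or tight to `m`; either forces `r
      -- m a`.
      have hbound : ∀ x ∈ s, f x < f m + 1 := fun x hx => by
        have h1 : ¬ f m + 1 < f x := fun h =>
          hma (hr_right _ _ _ ((hrf m hms x hx).2 h) (has x hx).le)
        have h2 : ¬ f m + 1 = f x := fun h =>
          hma ((hT _ _ ((hTf m hms x hx).2 h)).2.2.1 a (has x hx))
        exact lt_of_le_of_ne (not_lt.1 h1) (Ne.symm h2)
      have hTm : ∀ x ∈ s, T x a → x = m := fun x hx h => by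
        rcases lt_trichotomy x m with hxm | hxm | hxm
        · exact absurd (hlt x hx hxm) (hT _ _ h).2.1
        · exact hxm
        · exact absurd ((hT _ _ h).2.2.2 m hxm) hma
      by_cases hmT : T m a
      · refine ⟨f m + 1, hbound, fun x hx => ⟨fun h => ?_, fun h => hlt x hx ?_⟩,
          fun x hx => ⟨fun h => by rw [hTm x hx h], fun h => ?_⟩⟩
        · have : x < m := lt_of_not_ge fun hmx => hge x hx hmx h
          linarith [hmono x hx m hms this]
        · by_contra hmx
          linarith [hmono' x hx (not_lt.1 hmx)]
        · have : x = m := by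
            rcases lt_trichotomy x m with hxm | hxm | hxm
            · linarith [hmono x hx m hms hxm]
            · exact hxm
            · linarith [hmono m hms x hx hxm]
          rwa [this]
      -- Without tightness, a value slightly below `f m + 1` still clears all earlier positions and
      -- the thresholds of points before `m`.
      · obtain ⟨v, hvm, hv⟩ := exists_lt_forall_lt_of_finite (u := f m + 1)
          (S := f '' s ∪ (fun x => f x + 1) '' {x | x ∈ s ∧ x < m})
          ((s.finite_toSet.image f).union
            ((s.finite_toSet.subset fun x hx => hx.1).image _)) (by
            rintro _ (⟨x, hx, rfl⟩ | ⟨x, ⟨hx, hxm⟩, rfl⟩)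
            · exact hbound x hx
            · linarith [hmono x hx m hms hxm])
        have hv2 : ∀ x ∈ s, x < m → f x + 1 < v := fun x hx hxm =>
          hv _ (Or.inr ⟨x, ⟨hx, hxm⟩, rfl⟩)
        refine ⟨v, fun x hx => hv _ (Or.inl ⟨x, hx, rfl⟩),
          fun x hx => ⟨fun h => hv2 x hx (lt_of_not_ge fun hmx => hge x hx hmx h),
            fun h => hlt x hx ?_⟩,
          fun x hx => ⟨fun h => absurd (hTm x hx h ▸ h) hmT, fun h => ?_⟩⟩
        · by_contra hmx
          linarith [hmono' x hx (not_lt.1 hmx)]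
        · exfalso
          rcases lt_or_ge x m with hxm | hxm
          · linarith [hv2 x hx hxm]
          · linarith [hmono' x hx hxm]

end Greedy

/-! ### From forbidden posets to a representation -/

section Sufficiency

/-- A poset without an induced `2 + 2`. -/
def TwoPlusTwoFree (X : Type*) [PartialOrder X] : Prop :=
  ∀ a b c d : X, a < b → c < d → a < d ∨ c < b

variable {X : Type*} [PartialOrder X]

lemma IsIntervalOrder.twoPlusTwoFree (h : IsIntervalOrder X) : TwoPlusTwoFree X := by
  obtain ⟨I, -, hI⟩ := h
  intro a b c d hab hcd
  by_contra! hcon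
  obtain ⟨had, hcb⟩ := hcon
  rw [hI] at hab hcd had hcb
  simp only [SetPrecedes, not_forall, not_lt] at had hcb
  obtain ⟨p, hp, q, hq, hqp⟩ := had
  obtain ⟨p', hp', q', hq', hqp'⟩ := hcb
  linarith [hab p hp q' hq', hcd p' hp' q hq]

/-- The chain `a < b < c` together with `d` is an induced `3 + 1`; the incomparabilities not
listed follow from the listed relations. -/
structure IsThreePlusOne (a b c d : X) : Prop where
  ab : a < b
  bc : b < c
  ad : ¬ a < d
  dc : ¬ d < c

variable (X) in
/-- A `2 + 2`-free poset in which every induced `3 + 1` is determined by its chain, and by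
its incomparable point with two consecutive points of the chain, and no two overlap
as in `Z`. In a twin-free poset this also excludes `D`, whose middle points would be twins. -/
structure Admissible : Prop where
  two_two : TwoPlusTwoFree X
  eq_side : ∀ a b c d e : X, IsThreePlusOne a b c d → IsThreePlusOne a b c e → d = e
  eq_top : ∀ a b c d e : X, IsThreePlusOne a b c d → IsThreePlusOne a b e d → c = e
  eq_bot : ∀ a b c d e : X, IsThreePlusOne a b c d → IsThreePlusOne e b c d → a = e
  no_Z : ∀ x y z w u v : X, IsThreePlusOne x y z u → IsThreePlusOne y z w v → False

lemma containsInduced_of_lt_iff {Q : Type*} [PartialOrder Q] (f : Q → X)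
    (hf : Function.Injective f) (h : ∀ p q, f p < f q ↔ p < q) : ContainsInduced Q X :=
  ⟨OrderEmbedding.ofMapLEIff f fun p q => by
    rw [le_iff_lt_or_eq, le_iff_lt_or_eq, h, hf.eq_iff]⟩

lemma IsThreePlusOne.incomp {a b c d : X} (h : IsThreePlusOne a b c d) :
    a < c ∧ ¬ d < a ∧ ¬ d < b ∧ ¬ b < d ∧ ¬ c < d ∧ a ≠ d ∧ b ≠ d ∧ c ≠ d := by
  obtain ⟨h1, h2, h3, h4⟩ := h
  have h5 := h1.trans h2
  refine ⟨h5, fun h => h4 (h.trans h5), fun h => h4 (h.trans h2), fun h => h3 (h1.trans h),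
    fun h => h3 (h5.trans h), ?_, ?_, ?_⟩ <;> rintro rfl <;> contradiction

lemma not_four_one (hno : ¬ ContainsInduced FourPlusOne X) (a b c d e : X) (hab : a < b)
    (hbc : b < c) (hcd : c < d) (hae : ¬ a < e) (hed : ¬ e < d) : False := by
  have h1 := IsThreePlusOne.incomp (X := X) ⟨hab, hbc.trans hcd, hae, hed⟩
  have h2 := IsThreePlusOne.incomp (X := X) ⟨hab.trans hbc, hcd, hae, hed⟩
  refine hno (containsInduced_of_lt_iff (Sum.elim ![a, b, c, d] ![e]) ?_ ?_)
  · rintro (p | p) (q | q) <;> fin_cases p <;> fin_cases q <;> simp <;> grind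
  · rintro (p | p) (q | q) <;> fin_cases p <;> fin_cases q <;> simp <;> grind

lemma not_three_one_one (h22 : TwoPlusTwoFree X) (hno : ¬ ContainsInduced ThreePlusOnePlusOne X)
    (a b c d e : X) (hd : IsThreePlusOne a b c d) (he : IsThreePlusOne a b c e) : d = e := by
  by_contra hne
  have h1 := hd.incomp
  have h2 := he.incomp
  have h3 : ¬ d < e := fun h => by
    rcases h22 a b d e hd.ab h with h | h
    exacts [he.ad h, h1.2.2.1 h]
  have h4 : ¬ e < d := fun h => by
    rcases h22 a b e d hd.ab h with h | h
    exacts [hd.ad h, h2.2.2.1 h]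
  obtain ⟨hab, hbc, -, -⟩ := id hd
  obtain ⟨-, -, had, hdc⟩ := hd
  obtain ⟨-, -, hae, hec⟩ := he
  refine hno (containsInduced_of_lt_iff (Sum.elim ![a, b, c] (Sum.elim ![d] ![e])) ?_ ?_)
  · rintro (p | p | p) (q | q | q) <;> fin_cases p <;> fin_cases q <;> simp <;> grind
  · rintro (p | p | p) (q | q | q) <;> fin_cases p <;> fin_cases q <;> simp <;> grind

/-- Comparable tops would extend the chain to a 4+1; incomparable ones form `Y`. -/
lemma not_fork (hno4 : ¬ ContainsInduced FourPlusOne X) (hno : ¬ ContainsInduced PosetY X)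
    (x y z v w : X) (hz : IsThreePlusOne x y z v) (hw : IsThreePlusOne x y w v) : z = w := by
  by_contra hne
  have h1 := hz.incomp
  have h2 := hw.incomp
  have h3 : ¬ z < w := fun h => not_four_one hno4 x y z w v hz.ab hz.bc h hz.ad hw.dc
  have h4 : ¬ w < z := fun h => not_four_one hno4 x y w z v hz.ab hw.bc h hz.ad hz.dc
  obtain ⟨hxy, hyz, hxv, hvz⟩ := hz
  obtain ⟨-, hyw, -, hvw⟩ := hw
  let f : PosetY → X
    | .x => x
    | .y => y
    | .z => z
    | .w => w
    | .v => v
  refine hno (containsInduced_of_lt_iff f ?_ ?_)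
  · intro p q
    cases p <;> cases q <;> simp [f] <;> grind
  · intro p q
    rw [posetY_lt_iff]
    cases p <;> cases q <;> simp [f, PosetY.Below] <;> grind

lemma not_fork_dual (hno4 : ¬ ContainsInduced FourPlusOne X)
    (hno : ¬ ContainsInduced PosetYᵒᵈ X) (a b c d e : X) (ha : IsThreePlusOne a b c d)
    (he : IsThreePlusOne e b c d) : a = e := by
  have hno4' : ¬ ContainsInduced FourPlusOne Xᵒᵈ := by
    rintro ⟨f⟩
    have lt (p q : FourPlusOne) (hpq : p < q) :
        OrderDual.ofDual (f q) < OrderDual.ofDual (f p) := f.lt_iff_lt.2 hpq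
    have nlt (p q : FourPlusOne) (hpq : ¬ p < q) :
        ¬ OrderDual.ofDual (f q) < OrderDual.ofDual (f p) := fun h => hpq (f.lt_iff_lt.1 h)
    exact not_four_one hno4 _ _ _ _ _ (lt (.inl 2) (.inl 3) (by simp))
      (lt (.inl 1) (.inl 2) (by simp)) (lt (.inl 0) (.inl 1) (by simp))
      (nlt (.inr 0) (.inl 3) (by simp)) (nlt (.inl 0) (.inr 0) (by simp))
  rw [containsInduced_dual_iff] at hno
  exact not_fork (X := Xᵒᵈ) hno4' hno c b a d e ⟨ha.bc, ha.ab, ha.dc, ha.ad⟩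
    ⟨he.bc, he.ab, he.dc, he.ad⟩

/-- The cross relations u ≺ w and x ≺ v hold, since failure of either gives a 4+1; a relation
between u and v would violate 2+2-freeness. -/
lemma not_Z (h22 : TwoPlusTwoFree X) (hno4 : ¬ ContainsInduced FourPlusOne X)
    (hno : ¬ ContainsInduced PosetZ X) (x y z w u v : X) (hu : IsThreePlusOne x y z u)
    (hv : IsThreePlusOne y z w v) : False := by
  have h1 := hu.incomp
  have h2 := hv.incomp
  have h3 : u < w := by
    by_contra h
    exact not_four_one hno4 x y z w u hu.ab hu.bc hv.bc hu.ad h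
  have h4 : x < v := by
    by_contra h
    exact not_four_one hno4 x y z w v hu.ab hu.bc hv.bc h hv.dc
  have h5 : ¬ u < v := fun h => by
    rcases h22 y z u v hv.ab h with h | h
    exacts [hv.ad h, hu.dc h]
  have h6 : ¬ v < u := fun h => by
    rcases h22 x y v u hu.ab h with h | h
    exacts [hu.ad h, h2.2.1 h]
  obtain ⟨hxy, hyz, hxu, huz⟩ := hu
  obtain ⟨-, hzw, hyv, hvw⟩ := hv
  let f : PosetZ → X
    | .x => x
    | .y => y
    | .z => z
    | .w => w
    | .u => u
    | .v => v
  refine hno (containsInduced_of_lt_iff f ?_ ?_)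
  · intro p q
    cases p <;> cases q <;> simp [f] <;> grind
  · intro p q
    rw [posetZ_lt_iff]
    cases p <;> cases q <;> simp [f, PosetZ.Below] <;> grind

namespace Admissible

variable {a b c d z : X}

lemma lt_mid_of_lt_side (hX : Admissible X) (h : IsThreePlusOne a b c d) (hz : z < d) :
    z < b :=
  (hX.two_two a b z d h.ab hz).resolve_left h.ad

lemma mid_lt_of_side_lt (hX : Admissible X) (h : IsThreePlusOne a b c d) (hz : d < z) :
    b < z :=
  (hX.two_two b c d z h.bc hz).resolve_right h.dc

/-- A point above the middle but not above the side is the top of another 3+1 with the same bottom,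
middle and side. -/
lemma eq_top_or_side_lt (hX : Admissible X) (h : IsThreePlusOne a b c d) (hz : b < z) :
    z = c ∨ d < z :=
  or_iff_not_imp_right.2 fun hdz => (hX.eq_top a b c d z h ⟨h.ab, hz, h.ad, hdz⟩).symm

lemma eq_bot_or_lt_side (hX : Admissible X) (h : IsThreePlusOne a b c d) (hz : z < b) :
    z = a ∨ z < d :=
  or_iff_not_imp_right.2 fun hdz => (hX.eq_bot a b c d z h ⟨hz, h.bc, hdz, h.dc⟩).symm

end Admissible

/-- The middle elements of the induced `3 + 1`s. -/
def IsMiddle (b : X) : Prop := ∃ a c d, IsThreePlusOne a b c d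

namespace Admissible

variable {a b c d : X}

/-- If b is below the side of the second 3+1, then d is too, giving a 2+2; otherwise the two chains
overlap as in `Z`. -/
lemma not_isMiddle_top (hX : Admissible X) (h : IsThreePlusOne a b c d) : ¬ IsMiddle c := by
  rintro ⟨a', c', d', h'⟩
  by_cases hbd : b < d'
  · rcases hX.eq_top_or_side_lt h hbd with e | e
    · exact h'.incomp.2.2.2.2.2.2.1 e.symm
    · rcases hX.two_two _ _ _ _ h'.ab e with h1 | h1
      exacts [h'.ad h1, h.dc h1]
  · exact hX.no_Z a b c c' d d' h ⟨h.bc, h'.bc, hbd, h'.dc⟩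

lemma not_isMiddle_bot (hX : Admissible X) (h : IsThreePlusOne a b c d) : ¬ IsMiddle a := by
  rintro ⟨a', c', d', h'⟩
  by_cases hbd : d' < b
  · rcases hX.eq_bot_or_lt_side h hbd with e | e
    · exact h'.incomp.2.2.2.2.2.2.1 e.symm
    · rcases hX.two_two _ _ _ _ e h'.bc with h1 | h1
      exacts [h'.dc h1, h.ad h1]
  · exact hX.no_Z a' a b c d' d ⟨h'.ab, h.ab, h'.ad, hbd⟩ h

/-- The side of a 3+1 with middle d would be a second side of the given chain. -/
lemma not_isMiddle_side (hX : Admissible X) (h : IsThreePlusOne a b c d) : ¬ IsMiddle d := by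
  rintro ⟨a', c', d', h'⟩
  have h1 : ¬ a < d' := fun h1 => by
    rcases hX.two_two _ _ _ _ h1 h'.ab with h2 | h2
    exacts [h.ad h2, h'.ad h2]
  have h2 : ¬ d' < c := fun h2 => by
    rcases hX.two_two _ _ _ _ h2 h'.bc with h3 | h3
    exacts [h'.dc h3, h.dc h3]
  exact h'.incomp.2.2.2.2.2.2.1 (hX.eq_side a b c d d' h ⟨h.ab, h.bc, h1, h2⟩)

end Admissible

variable (X) in
/-- The elements that are not the middle of an induced `3 + 1`, to be ordered by their trace. -/
def NonMiddle : Type _ := {x : X // ¬ IsMiddle x}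

/-- The trace order of a poset. -/
def TraceLE (x y : X) : Prop := (∀ z, y < z → x < z) ∧ ∀ z, z < x → z < y

/-- Two failures on the same side of the order give a 2+2; one above and one below make x or y a
middle. -/
lemma TraceLE.total (h22 : TwoPlusTwoFree X) {x y : X} (hx : ¬ IsMiddle x)
    (hy : ¬ IsMiddle y) : TraceLE x y ∨ TraceLE y x := by
  by_contra! hcon
  simp only [TraceLE, not_and_or, not_forall] at hcon
  obtain ⟨⟨z, hz, hz'⟩ | ⟨z, hz, hz'⟩, ⟨w, hw, hw'⟩ | ⟨w, hw, hw'⟩⟩ := hcon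
  · rcases h22 _ _ _ _ hz hw with h | h
    exacts [hw' h, hz' h]
  · exact hy ⟨w, z, x, hw, hz, hw', hz'⟩
  · exact hx ⟨z, w, y, hz, hw, hz', hw'⟩
  · rcases h22 _ _ _ _ hz hw with h | h
    exacts [hz' h, hw' h]

/-- The elements that are not in the middle of a `3 + 1` are linearly ordered by their trace. -/
noncomputable abbrev traceLinearOrder (h22 : TwoPlusTwoFree X) (htf : IsTwinFree X) :
    LinearOrder (NonMiddle X) where
  le x y := TraceLE x.1 y.1
  le_refl x := ⟨fun _ => id, fun _ => id⟩
  le_trans x y z h h' := ⟨fun w hw => h.1 w (h'.1 w hw), fun w hw => h'.2 w (h.2 w hw)⟩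
  le_antisymm x y h h' := by
    by_contra hne
    exact htf x.1 y.1 ⟨fun e => hne (Subtype.ext e),
      fun z => ⟨⟨h.2 z, h'.2 z⟩, ⟨h'.1 z, h.1 z⟩⟩⟩
  le_total x y := TraceLE.total h22 x.2 y.2
  toDecidableLE := Classical.decRel _

/-- The pairs that must be at exactly unit distance in a unit representation. -/
def IsTight (x y : X) : Prop :=
  (∃ a b, IsThreePlusOne a b y x) ∨ ∃ b c, IsThreePlusOne x b c y

lemma Admissible.exists_position [Finite X] (hX : Admissible X) (htf : IsTwinFree X) :
    ∃ f : NonMiddle X → ℝ, Function.Injective f ∧ (∀ x y, x.1 < y.1 ↔ f x + 1 < f y) ∧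
      ∀ x y, IsTight x.1 y.1 → f x + 1 = f y := by
  let _ := traceLinearOrder hX.two_two htf
  have hle : ∀ x y : NonMiddle X, x ≤ y ↔ TraceLE x.1 y.1 := fun _ _ => Iff.rfl
  have : Finite (NonMiddle X) := inferInstanceAs (Finite {x : X // ¬ IsMiddle x})
  have hlt : ∀ x y : NonMiddle X, x < y → TraceLE x.1 y.1 ∧ x.1 ≠ y.1 :=
    fun x y h => ⟨h.le, fun e => h.ne (Subtype.ext e)⟩
  have hr : ∀ x y : NonMiddle X, x.1 < y.1 → x < y := fun x y hxy =>
    lt_of_not_ge fun h => lt_irrefl _ (((hle _ _).1 h).1 _ hxy)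
  have htight : ∀ x y : NonMiddle X, IsTight x.1 y.1 → x < y ∧ ¬ x.1 < y.1 ∧
      (∀ z : NonMiddle X, y < z → x.1 < z.1) ∧ ∀ z : NonMiddle X, z < x → z.1 < y.1 := by
    -- Tight pairs are extremal in the trace order: a counterexample would be a second top, bottom
    -- or side of the same 3+1.
    rintro x y (⟨a, b, h⟩ | ⟨b, c, h⟩)
    · refine ⟨lt_of_not_ge fun hyx => ?_, h.dc, fun z hz => ?_, fun z hz => ?_⟩
      · exact h.incomp.2.2.2.1 (hyx.2 _ h.bc)
      · obtain ⟨hz, hne⟩ := hlt _ _ hz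
        exact (hX.eq_top_or_side_lt h (hz.2 _ h.bc)).resolve_left hne.symm
      · obtain ⟨hz, hne⟩ := hlt _ _ hz
        by_contra hzy
        exact hne (hX.eq_side _ _ _ _ _ h ⟨h.ab, h.bc, fun haz => h.ad (hz.2 _ haz), hzy⟩).symm
    · refine ⟨lt_of_not_ge fun hyx => ?_, h.ad, fun z hz => ?_, fun z hz => ?_⟩
      · exact h.incomp.2.2.1 (hyx.1 _ h.ab)
      · obtain ⟨hz, hne⟩ := hlt _ _ hz
        by_contra hzy
        exact hne (hX.eq_side _ _ _ _ _ h ⟨h.ab, h.bc, hzy, fun hzc => h.dc (hz.1 _ hzc)⟩)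
      · obtain ⟨hz, hne⟩ := hlt _ _ hz
        exact (hX.eq_bot_or_lt_side h (hz.1 _ h.ab)).resolve_left hne
  obtain ⟨f, h1, h2, h3⟩ := exists_tight_unit_rep (α := NonMiddle X)
    (fun x y => x.1 < y.1) (fun x y => IsTight x.1 y.1) hr
    (fun x y z hxy hyz => ((hle _ _).1 hyz).2 _ hxy)
    (fun x y z hxy hyz => ((hle _ _).1 hxy).1 _ hyz) htight
  exact ⟨f, h1.injective, h2, h3⟩

lemma Admissible.exists_isUnitRep [Finite X] (hX : Admissible X) (htf : IsTwinFree X) :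
    ∃ (g : X → ℝ) (o : X → Prop), IsUnitRep 1 g o := by
  classical
  obtain ⟨f, hinj, hf, hT⟩ := hX.exists_position htf
  -- The position of a point is that of itself or, for a middle, of a chosen side.
  have key : ∀ x : X, ∃ y : NonMiddle X, (¬ IsMiddle x ∧ x = y.1) ∨
      ∃ a c : NonMiddle X, IsThreePlusOne a.1 x c.1 y.1 := by
    intro x
    by_cases hx : IsMiddle x
    · obtain ⟨a, c, d, h⟩ := id hx
      exact ⟨⟨d, hX.not_isMiddle_side h⟩,
        Or.inr ⟨⟨a, hX.not_isMiddle_bot h⟩, ⟨c, hX.not_isMiddle_top h⟩, h⟩⟩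
    · exact ⟨⟨x, hx⟩, Or.inl ⟨hx, rfl⟩⟩
  choose p hp using key
  have hle : ∀ x y : NonMiddle X, f x + 1 ≤ f y ↔ x.1 < y.1 ∨ f x + 1 = f y := fun x y => by
    rw [hf, le_iff_lt_or_eq]
  -- comparisons of a middle element with a non-middle element
  have up : ∀ (a c : NonMiddle X) (x : X) (d y : NonMiddle X), IsThreePlusOne a.1 x c.1 d.1 →
      (x < y.1 ↔ f d + 1 ≤ f y) := by
    intro a c x d y h
    have hc : f d + 1 = f c := hT d c (Or.inl ⟨_, _, h⟩)
    rw [hle]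
    refine ⟨fun hxy => ?_, ?_⟩
    · rcases hX.eq_top_or_side_lt h hxy with e | e
      · exact Or.inr (by rw [hc, Subtype.ext e])
      · exact Or.inl e
    · rintro (e | e)
      · exact hX.mid_lt_of_side_lt h e
      -- Injectivity of `f` leaves the top as the only non-middle point exactly one unit to the
      -- right.
      · rw [← hinj (hc.symm.trans e)]
        exact h.bc
  have down : ∀ (a c : NonMiddle X) (x : X) (d y : NonMiddle X),
      IsThreePlusOne a.1 x c.1 d.1 → (y.1 < x ↔ f y + 1 ≤ f d) := by
    intro a c x d y h
    have ha : f a + 1 = f d := hT a d (Or.inr ⟨_, _, h⟩)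
    rw [hle]
    refine ⟨fun hxy => ?_, ?_⟩
    · rcases hX.eq_bot_or_lt_side h hxy with e | e
      · exact Or.inr (by rw [← ha, Subtype.ext e])
      · exact Or.inl e
    · rintro (e | e)
      · exact hX.lt_mid_of_lt_side h e
      · rw [hinj (add_right_cancel (e.trans ha.symm))]
        exact h.ab
  have both : ∀ (a c : NonMiddle X) (x : X) (d a' c' : NonMiddle X) (x' : X)
      (d' : NonMiddle X), IsThreePlusOne a.1 x c.1 d.1 → IsThreePlusOne a'.1 x' c'.1 d'.1 →
      (x < x' ↔ f d + 1 ≤ f d') := by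
    intro a c x d a' c' x' d' h h'
    refine ⟨fun hxx => ?_,
      fun hdd => hX.lt_mid_of_lt_side h' ((up _ _ _ _ _ h).2 hdd)⟩
    -- The exceptional case makes the second middle a top, which is never a middle.
    refine (down _ _ _ _ _ h').1 ((hX.eq_top_or_side_lt h hxx).resolve_left ?_)
    rintro rfl
    exact c.2 ⟨_, _, _, h'⟩
  refine ⟨fun x => f (p x), IsMiddle, fun x y => ?_⟩
  rcases hp x with ⟨hx, ex⟩ | ⟨a, c, hx⟩ <;> rcases hp y with ⟨hy, ey⟩ | ⟨a', c', hy⟩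
  · simp only [hx, hy, or_self, and_false, or_false]
    rw [← hf, ← ex, ← ey]
  · have hy' : IsMiddle y := ⟨_, _, _, hy⟩
    simp only [hy', or_true, and_true]
    rw [← le_iff_lt_or_eq, ← down _ _ _ _ _ hy, ← ex]
  · have hx' : IsMiddle x := ⟨_, _, _, hx⟩
    simp only [hx', true_or, and_true]
    rw [← le_iff_lt_or_eq, ← up _ _ _ _ _ hx, ← ey]
  · have hx' : IsMiddle x := ⟨_, _, _, hx⟩
    simp only [hx', true_or, and_true]
    rw [← le_iff_lt_or_eq, both _ _ _ _ _ _ _ _ hx hy]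

end Sufficiency

theorem mainTheorem4 (X : Type*) [PartialOrder X] [Finite X] (hX : IsTwinFree X) :
    List.TFAE [
      IsUnitOCIntervalOrder X,
      IsSOrder {IntervalType.A, IntervalType.B} X,
      IsIntervalOrder X ∧
        ¬ ContainsInduced FourPlusOne X ∧
        ¬ ContainsInduced ThreePlusOnePlusOne X ∧
        ¬ ContainsInduced PosetZ X ∧
        ¬ ContainsInduced PosetD X ∧
        ¬ ContainsInduced PosetY X ∧
        ¬ ContainsInduced PosetYᵒᵈ X] := by
  tfae_have 1 ↔ 2 := isUnitOCIntervalOrder_iff.trans isSOrder_AB_iff.symm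
  tfae_have 1 → 3 := by
    intro hP
    obtain ⟨g, o, h⟩ := isUnitOCIntervalOrder_iff.1 hP
    exact ⟨hP.isIntervalOrder, h.not_fourPlusOne, h.not_threePlusOnePlusOne hX, h.not_posetZ,
      h.not_posetD hX, h.not_posetY hX,
      fun hY => h.dual.not_posetY hX.dual (containsInduced_dual_iff.1 hY)⟩
  tfae_have 3 → 1 := by
    rintro ⟨hI, h41, h311, hZ, -, hY, hY'⟩
    have h22 := hI.twoPlusTwoFree
    have hP : Admissible X :=
      ⟨h22, not_three_one_one h22 h311, not_fork h41 hY, not_fork_dual h41 hY',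
        not_Z h22 h41 hZ⟩
    exact isUnitOCIntervalOrder_iff.2 (hP.exists_isUnitRep hX)
  tfae_finish
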